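/- Let $n_1,n_2,n_3\ge 2$, $r,s$ and $1\le m\le n_1n_2n_3$ be integers with $0\le r\le\min\{n_1,n_2\}$ and $r\le s\le rn_2n_3$, and let $b\ge 0$, $\sigma>0$ be real. For $\mathcal{A}\in\mathbb{R}^{n_1\times r\times n_3}$ and $\mathcal{B}\in\mathbb{R}^{r\times n_2\times n_3}$ let $\mathcal{A}\diamond\mathcal{B}\in\mathbb{R}^{n_1\times n_2\times n_3}$ be the tensor-tensor product, whose $k$-th frontal slice is $\sum_{l=1}^{n_3}\mathbf{A}^{(k-l+1)}\mathbf{B}^{(l)}$, where $\mathbf{A}^{(l)},\mathbf{B}^{(l)}$ denote the $l$-th frontal slices and the indices of the slices are read modulo $n_3$. Let $\mathfrak{U}(r,b,s)$ be the set of the tensors $\mathcal{X}=\mathcal{A}\diamond\mathcal{B}$ with nonnegative entries such that $0\le\mathcal{A}_{ijk}\le 1$ and $0\le\mathcal{B}_{ijk}\le b$ for all $i,j,k$, and $\mathcal{B}$ has at most $s$ nonzero entries. Let $\Omega$ be a random set of positions that contains each position $(i,j,k)$ independently with probability $m/(n_1n_2n_3)$; given $\Omega$, one observes $\mathcal{Y}_\Omega=(\mathcal{Y}_{ijk})_{(i,j,k)\in\Omega}$,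 where $\mathcal{Y}_{ijk}=\mathcal{X}^*_{ijk}+\sigma\epsilon_{ijk}$ with independent $\epsilon_{ijk}\sim N(0,1)$. Put $\Delta=\min\{1,\,s/(n_2n_3)\}$. Then there exist absolute constants $C,\beta_c>0$ (independent of $n_1,n_2,n_3,r,s,m,b,\sigma$) such that $$\inf_{\widetilde{\mathcal{X}}}\ \sup_{\mathcal{X}^*\in\mathfrak{U}(r,b,s)}\frac{\mathbb{E}_{\Omega,\mathcal{Y}_\Omega}\|\widetilde{\mathcal{X}}-\mathcal{X}^*\|_F^2}{n_1n_2n_3}\ \ge\ C\min\left\{\Delta b^2,\ \beta_c^2\sigma^2\,\frac{s+rn_1n_3}{m}\right\},$$ where $\|\cdot\|_F$ is the Frobenius norm and the infimum is over all estimators, i.e. all measurable functions $\widetilde{\mathcal{X}}=\widetilde{\mathcal{X}}(\Omega,\mathcal{Y}_\Omega)$ with values in $\mathbb{R}^{n_1\times n_2\times n_3}$. -/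

import Mathlib

open scoped ENNReal

namespace SparseNTF

/-- Real third-order tensors of size `n₁ × n₂ × n₃`; the entry `(i, j, k)` of `X` is `X i j k`. -/
abbrev Tensor (n₁ n₂ n₃ : ℕ) : Type := Fin n₁ → Fin n₂ → Fin n₃ → ℝ

/-- The set of all entry positions of an `n₁ × n₂ × n₃` tensor. -/
abbrev Idx (n₁ n₂ n₃ : ℕ) : Type := Fin n₁ × Fin n₂ × Fin n₃

/-- The frontal slices of `X`, stacked on top of each other: the block row `k` is the `k`-th
frontal slice. -/
def unfold {n₁ n₂ n₃ : ℕ} (X : Tensor n₁ n₂ n₃) : Matrix (Fin n₃ × Fin n₁) (Fin n₂) ℝ :=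
  Matrix.of fun ki j => X ki.2 j ki.1

/-- The inverse of `unfold`. -/
def fold {n₁ n₂ n₃ : ℕ} (M : Matrix (Fin n₃ × Fin n₁) (Fin n₂) ℝ) : Tensor n₁ n₂ n₃ :=
  fun i j k => M (k, i) j

/-- The block circulant matrix whose first block column is `M`: the block `(k, l)` is the block
`k - l` of `M`, the subtraction in `Fin n₃` being modulo `n₃`. -/
def circ {n₁ n₂ n₃ : ℕ} (M : Matrix (Fin n₃ × Fin n₁) (Fin n₂) ℝ) :
    Matrix (Fin n₃ × Fin n₁) (Fin n₃ × Fin n₂) ℝ :=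
  Matrix.of fun ki lp => M (ki.1 - lp.1, ki.2) lp.2

/-- The tensor-tensor product. -/
def tensorProd {n₁ n₂ n₃ n₄ : ℕ} (X : Tensor n₁ n₂ n₃) (Y : Tensor n₂ n₄ n₃) : Tensor n₁ n₄ n₃ :=
  fold (circ (unfold X) * unfold Y)

/-- The tensor `ℓ₀` norm: the number of nonzero entries. -/
noncomputable def l0Norm {n₁ n₂ n₃ : ℕ} (X : Tensor n₁ n₂ n₃) : ℕ :=
  {p : Idx n₁ n₂ n₃ | X p.1 p.2.1 p.2.2 ≠ 0}.ncard

/-- The Frobenius norm. -/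
noncomputable def frobNorm {n₁ n₂ n₃ : ℕ} (X : Tensor n₁ n₂ n₃) : ℝ :=
  Real.sqrt (∑ i, ∑ j, ∑ k, X i j k ^ 2)

/-- The class of nonnegative tensors `X = A ⋄ B` where `A` has entries in `[0, 1]`, and `B` has
entries in `[0, b]`, at most `s` of them nonzero. -/
def candidateSet (n₁ n₂ n₃ r : ℕ) (b : ℝ) (s : ℕ) : Set (Tensor n₁ n₂ n₃) :=
  {X | (∀ i j k, 0 ≤ X i j k) ∧
    ∃ (A : Tensor n₁ r n₃) (B : Tensor r n₂ n₃), X = tensorProd A B ∧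
      (∀ i j k, 0 ≤ A i j k ∧ A i j k ≤ 1) ∧
      (∀ i j k, 0 ≤ B i j k ∧ B i j k ≤ b) ∧
      l0Norm B ≤ s}

/-- The probability of the set `Ω` when every position is observed independently with
probability `γ`. -/
noncomputable def bernWeight {n₁ n₂ n₃ : ℕ} (γ : ℝ) (Ω : Finset (Idx n₁ n₂ n₃)) : ℝ≥0∞ :=
  ENNReal.ofReal (γ ^ Ω.card * (1 - γ) ^ Ωᶜ.card)

/-- The law of the observed vector `Y_Ω = (Y_p)_{p ∈ Ω}` under additive Gaussian noise with
standard deviation `σ`: the entries are independent, and `Y_p` has the law `N(X_p, σ²)`. -/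
noncomputable def gaussianObs {n₁ n₂ n₃ : ℕ} (σ : ℝ) (X : Tensor n₁ n₂ n₃)
    (Ω : Finset (Idx n₁ n₂ n₃)) : MeasureTheory.Measure (Ω → ℝ) :=
  MeasureTheory.Measure.pi fun p : Ω =>
    ProbabilityTheory.gaussianReal (X p.1.1 p.1.2.1 p.1.2.2) (Real.toNNReal (σ ^ 2))

/-- An estimator: a measurable function of the observed data `(Ω, Y_Ω)`. -/
structure Estimator (n₁ n₂ n₃ : ℕ) where
  /-- The estimate from the data `(Ω, Y_Ω)`. -/
  est : (Ω : Finset (Idx n₁ n₂ n₃)) → (Ω → ℝ) → Tensor n₁ n₂ n₃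
  measurable_est : ∀ Ω, Measurable (est Ω)

/-- The risk `𝔼_{Ω, Y_Ω} ‖X̃ - X‖_F² / (n₁ n₂ n₃)` of the estimator `T` at the tensor `X`, where
`Ω ∼ Bern(m / (n₁ n₂ n₃))`. -/
noncomputable def risk {n₁ n₂ n₃ : ℕ} (m : ℕ) (σ : ℝ) (T : Estimator n₁ n₂ n₃)
    (X : Tensor n₁ n₂ n₃) : ℝ≥0∞ :=
  (∑ Ω : Finset (Idx n₁ n₂ n₃), bernWeight ((m : ℝ) / ((n₁ : ℝ) * n₂ * n₃)) Ω *
      ∫⁻ y, ENNReal.ofReal (frobNorm (T.est Ω y - X) ^ 2) ∂(gaussianObs σ X Ω)) /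
    ((n₁ : ℝ≥0∞) * n₂ * n₃)

/-- The minimax risk over the class `candidateSet n₁ n₂ n₃ r b s`. -/
noncomputable def minimaxRisk (n₁ n₂ n₃ r : ℕ) (b : ℝ) (s m : ℕ) (σ : ℝ) : ℝ≥0∞ :=
  ⨅ T : Estimator n₁ n₂ n₃, ⨆ X ∈ candidateSet n₁ n₂ n₃ r b s, risk m σ T X

/-- `Δ = min {1, s / (n₂ n₃)}`. -/
noncomputable def Delta (n₂ n₃ s : ℕ) : ℝ := min 1 ((s : ℝ) / ((n₂ : ℝ) * n₃))

end SparseNTF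

namespace SparseNTF

open MeasureTheory ProbabilityTheory

/-! This is Assouad's method, applied to two hypercubes inside the class. In the first, a fixed
sparse `B` copies columns of an unknown `A`; in the second, a fixed 0-1 tensor `A` copies rows of an
unknown sparse `B`. In both, each entry of the product is either identically `0` or `h` times one
free bit, and each bit governs at most `N` entries.

Flipping a bit changes the mean of about `γ N` observed entries by `h`, where `γ` is the sampling
rate. If `2 γ h² N ≤ σ²`, the two laws are too close to separate, and every governed entry costs a
multiple of `h²` on average over the cube. The two-point step (`two_point_lower_bound`) uses the
second moment of the likelihood ratio, which is explicit for Gaussians and factorizes over entries;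
`iSup_risk_ge_of_cube` averages over the cube.

With `h` as large as both `h ≤ b` and the noise condition permit, the cubes give `min (Δ b²) (σ² r
n₁ n₃ / m)` and `min (Δ b²) (σ² s / m)` up to constants. The larger of the two dominates the claimed
rate up to a factor of two. -/

/-! ### Gaussian likelihood ratios and the two-point bound -/

theorem lintegral_pi_prod {ι : Type*} [Fintype ι] {α : ι → Type*} [∀ i, MeasurableSpace (α i)]
    (μ : ∀ i, Measure (α i)) [∀ i, IsProbabilityMeasure (μ i)] (f : ∀ i, α i → ℝ≥0∞)
    (hf : ∀ i, Measurable (f i)) :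
    ∫⁻ x, ∏ i, f i (x i) ∂(Measure.pi μ) = ∏ i, ∫⁻ x, f i x ∂(μ i) := by
  have hind : iIndepFun (fun i (x : ∀ i, α i) => f i (x i)) (Measure.pi μ) :=
    iIndepFun_pi fun i => (hf i).aemeasurable
  rw [lintegral_prod_eq_prod_lintegral_of_indepFun _ _ hind
    fun i => (hf i).comp (measurable_pi_apply i)]
  refine Finset.prod_congr rfl fun i _ => ?_
  exact (measurePreserving_eval μ i).lintegral_comp (hf i)

/-- It suffices to compare the measures on boxes, where the indicator is a product of one-variable
indicators and the integral factorizes. -/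
theorem pi_withDensity_prod {ι : Type*} [Fintype ι] {α : ι → Type*} [∀ i, MeasurableSpace (α i)]
    (μ ν : ∀ i, Measure (α i)) [∀ i, IsProbabilityMeasure (μ i)] [∀ i, IsProbabilityMeasure (ν i)]
    (f : ∀ i, α i → ℝ≥0∞) (hf : ∀ i, Measurable (f i)) (h : ∀ i, ν i = (μ i).withDensity (f i)) :
    Measure.pi ν = (Measure.pi μ).withDensity fun x => ∏ i, f i (x i) := by
  refine Measure.pi_eq fun s hs => ?_
  rw [withDensity_apply _ (MeasurableSet.univ_pi hs),
    ← lintegral_indicator (MeasurableSet.univ_pi hs)]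
  have : (Set.univ.pi s).indicator (fun x => ∏ i, f i (x i))
      = fun x => ∏ i, (s i).indicator (f i) (x i) := by
    classical
    ext x
    by_cases hx : x ∈ Set.univ.pi s
    · rw [Set.indicator_of_mem hx]
      exact Finset.prod_congr rfl fun i _ => (Set.indicator_of_mem (hx i trivial) _).symm
    · rw [Set.indicator_of_notMem hx]
      obtain ⟨i, hi⟩ : ∃ i, x i ∉ s i := by simpa using hx
      exact (Finset.prod_eq_zero (Finset.mem_univ i) (Set.indicator_of_notMem hi _)).symm
  rw [this, lintegral_pi_prod μ _ fun i => (hf i).indicator (hs i)]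
  refine Finset.prod_congr rfl fun i _ => ?_
  rw [lintegral_indicator (hs i), h i, withDensity_apply _ (hs i)]

/-- The likelihood ratio of `N(b, v)` with respect to `N(a, v)`. -/
noncomputable def gaussianRatio (a b v x : ℝ) : ℝ :=
  Real.exp ((b - a) / v * x - (b ^ 2 - a ^ 2) / (2 * v))

theorem measurable_gaussianRatio (a b v : ℝ) : Measurable (gaussianRatio a b v) := by
  unfold gaussianRatio; fun_prop

theorem gaussianReal_eq_withDensity (a b : ℝ) {v : NNReal} (hv : v ≠ 0) :
    gaussianReal b v
      = (gaussianReal a v).withDensity fun x => ENNReal.ofReal (gaussianRatio a b v x) := by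
  rw [gaussianReal_of_var_ne_zero _ hv, gaussianReal_of_var_ne_zero _ hv,
    ← withDensity_mul _ (measurable_gaussianPDF _ _) (measurable_gaussianRatio _ _ _).ennreal_ofReal]
  congr 1
  ext x
  have hv' : (v : ℝ) ≠ 0 := by exact_mod_cast hv
  simp only [Pi.mul_apply, gaussianPDF]
  rw [← ENNReal.ofReal_mul (gaussianPDFReal_nonneg _ _ _)]
  congr 1
  rw [gaussianPDFReal, gaussianPDFReal, gaussianRatio, mul_assoc _ (Real.exp _), ← Real.exp_add]
  congr 2
  field_simp
  ring

/-- Completing the square: the squared ratio is a constant times the likelihood ratio of the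
Gaussian with mean `2 * b - a`, which integrates to one. -/
theorem lintegral_gaussianRatio_sq (a b : ℝ) {v : NNReal} (hv : v ≠ 0) :
    ∫⁻ x, ENNReal.ofReal (gaussianRatio a b v x ^ 2) ∂(gaussianReal a v)
      = ENNReal.ofReal (Real.exp ((b - a) ^ 2 / v)) := by
  have hv' : (v : ℝ) ≠ 0 := by exact_mod_cast hv
  have key : ∀ x, gaussianRatio a b v x ^ 2
      = Real.exp ((b - a) ^ 2 / v) * gaussianRatio a (2 * b - a) v x := by
    intro x
    rw [gaussianRatio, gaussianRatio, ← Real.exp_nat_mul, ← Real.exp_add]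
    congr 1
    push_cast
    field_simp
    ring
  simp_rw [key, ENNReal.ofReal_mul (Real.exp_pos _).le]
  rw [lintegral_const_mul _ (measurable_gaussianRatio _ _ _).ennreal_ofReal,
    ← setLIntegral_univ, ← withDensity_apply _ MeasurableSet.univ,
    ← gaussianReal_eq_withDensity a _ hv, measure_univ, mul_one]

/-- A two-point lower bound for the squared loss, in terms of the second moment of the
likelihood ratio. -/
theorem two_point_lower_bound {Ω : Type*} [MeasurableSpace Ω] (P Q : Measure Ω)
    [IsProbabilityMeasure Q] (l f : Ω → ℝ) (hl : Measurable l) (hl0 : ∀ x, 0 ≤ l x)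
    (hf : Measurable f) (hQ : Q = P.withDensity fun x => ENNReal.ofReal (l x)) (v : ℝ)
    (hv : 0 ≤ v)
    (hsq : ∫⁻ x, ENNReal.ofReal (l x ^ 2) ∂P ≤ ENNReal.ofReal (Real.exp v)) (a b : ℝ) :
    ENNReal.ofReal ((a - b) ^ 2 * (1 - v) / 2) ≤
      ∫⁻ x, ENNReal.ofReal ((f x - a) ^ 2) ∂P + ∫⁻ x, ENNReal.ofReal ((f x - b) ^ 2) ∂Q := by
  rcases lt_or_ge 1 v with h1 | h1
  · rw [ENNReal.ofReal_of_nonpos (by nlinarith [sq_nonneg (a - b)])]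
    exact zero_le
  set S := ∫⁻ x, ENNReal.ofReal ((f x - a) ^ 2) ∂P + ∫⁻ x, ENNReal.ofReal ((f x - b) ^ 2) ∂Q
    with hS
  have hlQ : ∫⁻ x, ENNReal.ofReal (l x) ∂P = 1 := by
    rw [← setLIntegral_univ, ← withDensity_apply _ MeasurableSet.univ, ← hQ, measure_univ]
  have hQint : ∫⁻ x, ENNReal.ofReal ((f x - b) ^ 2) ∂Q
      = ∫⁻ x, ENNReal.ofReal (l x * (f x - b) ^ 2) ∂P := by
    rw [hQ, lintegral_withDensity_eq_lintegral_mul _ hl.ennreal_ofReal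
      (by fun_prop : Measurable fun x => ENNReal.ofReal ((f x - b) ^ 2))]
    refine lintegral_congr fun x => ?_
    rw [Pi.mul_apply, ENNReal.ofReal_mul (hl0 x)]
  have key : ENNReal.ofReal (3 * (a - b) ^ 2) ≤
      ENNReal.ofReal 4 * S + ENNReal.ofReal ((a - b) ^ 2) * ENNReal.ofReal (Real.exp v) := by
    calc ENNReal.ofReal (3 * (a - b) ^ 2)
        = ∫⁻ x, ENNReal.ofReal (3 * (a - b) ^ 2) * ENNReal.ofReal (l x) ∂P := by
          rw [lintegral_const_mul _ hl.ennreal_ofReal, hlQ, mul_one]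
      _ ≤ ∫⁻ x, ENNReal.ofReal 4 * (ENNReal.ofReal ((f x - a) ^ 2)
            + ENNReal.ofReal (l x * (f x - b) ^ 2))
            + ENNReal.ofReal ((a - b) ^ 2) * ENNReal.ofReal (l x ^ 2) ∂P := by
          refine lintegral_mono fun x => ?_
          have hx := hl0 x
          dsimp only
          rw [← ENNReal.ofReal_add (by positivity) (by positivity),
            ← ENNReal.ofReal_mul (by positivity), ← ENNReal.ofReal_mul (by positivity),
            ← ENNReal.ofReal_mul (sq_nonneg _),
            ← ENNReal.ofReal_add (by positivity) (by positivity)]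
          refine ENNReal.ofReal_le_ofReal ?_
          -- Minimizing over the value of `f x` gives `(f - a)² + l (f - b)² ≥ (a - b)² l / (1 +
          -- l)`, and `4 l / (1 + l) ≥ 3 l - l²` because `l (1 - l)² ≥ 0`. Multiplying by `1 + l`
          -- turns both facts into one sum of nonnegative terms.
          have h3 : 0 ≤ (1 + l x) * (4 * ((f x - a) ^ 2 + l x * (f x - b) ^ 2)
              + (a - b) ^ 2 * l x ^ 2 - 3 * (a - b) ^ 2 * l x) := by
            have : (1 + l x) * (4 * ((f x - a) ^ 2 + l x * (f x - b) ^ 2)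
              + (a - b) ^ 2 * l x ^ 2 - 3 * (a - b) ^ 2 * l x)
              = 4 * ((f x - a) + l x * (f x - b)) ^ 2 + (a - b) ^ 2 * (l x * (1 - l x) ^ 2) := by
              ring
            rw [this]; positivity
          have := nonneg_of_mul_nonneg_right h3 (by linarith)
          linarith
      _ = ENNReal.ofReal 4 * S
            + ENNReal.ofReal ((a - b) ^ 2) * ∫⁻ x, ENNReal.ofReal (l x ^ 2) ∂P := by
          rw [lintegral_add_left (by fun_prop), lintegral_const_mul _ (by fun_prop),
            lintegral_const_mul _ (by fun_prop), lintegral_add_left (by fun_prop), hS, hQint]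
      _ ≤ _ := by gcongr
  rcases eq_or_ne S ⊤ with hT | hT
  · rw [hT]; exact le_top
  rw [← ENNReal.ofReal_toReal hT] at key ⊢
  refine ENNReal.ofReal_le_ofReal ?_
  rw [← ENNReal.ofReal_mul (by norm_num), ← ENNReal.ofReal_mul (by positivity),
    ← ENNReal.ofReal_add (by positivity) (by positivity),
    ENNReal.ofReal_le_ofReal_iff (by positivity)] at key
  -- Since `v ≤ 1` here, this linear bound turns `4 S ≥ (a - b)² (3 - exp v)` into the claim.
  have hexp : Real.exp v ≤ 1 + 2 * v := by
    have := Real.abs_exp_sub_one_le (x := v) (by rwa [abs_of_nonneg hv])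
    rw [abs_of_nonneg hv] at this
    linarith [le_abs_self (Real.exp v - 1)]
  have := mul_le_mul_of_nonneg_left hexp (sq_nonneg (a - b))
  linarith

/-- By independence the likelihood ratio is a product, so its second moments multiply and the
exponents `(ν i - μ i)² / v` add up. -/
theorem pi_gaussian_two_point {ι : Type*} [Fintype ι] (μ ν : ι → ℝ) {v : NNReal} (hv : v ≠ 0)
    (f : (ι → ℝ) → ℝ) (hf : Measurable f) (a b : ℝ) :
    ENNReal.ofReal ((a - b) ^ 2 * (1 - ∑ i, (ν i - μ i) ^ 2 / v) / 2) ≤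
      ∫⁻ x, ENNReal.ofReal ((f x - a) ^ 2) ∂(Measure.pi fun i => gaussianReal (μ i) v) +
      ∫⁻ x, ENNReal.ofReal ((f x - b) ^ 2) ∂(Measure.pi fun i => gaussianReal (ν i) v) := by
  have hpos : ∀ i x, 0 ≤ gaussianRatio (μ i) (ν i) v x := fun i x => (Real.exp_pos _).le
  have hmeas : Measurable fun x : ι → ℝ => ∏ i, gaussianRatio (μ i) (ν i) v (x i) := by
    refine Finset.measurable_prod _ fun i _ => ?_
    exact (measurable_gaussianRatio (μ i) (ν i) v).comp (measurable_pi_apply i)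
  refine two_point_lower_bound _ _ _ f hmeas (fun x => Finset.prod_nonneg fun i _ => hpos i _) hf
    ?_ _ (Finset.sum_nonneg fun i _ => by positivity) ?_ a b
  · have h : (fun x : ι → ℝ => ENNReal.ofReal (∏ i, gaussianRatio (μ i) (ν i) v (x i)))
        = fun x => ∏ i, ENNReal.ofReal (gaussianRatio (μ i) (ν i) v (x i)) :=
      funext fun x => ENNReal.ofReal_prod_of_nonneg fun i _ => hpos i _
    rw [h]
    exact pi_withDensity_prod _ _
      (fun i x => ENNReal.ofReal (gaussianRatio (μ i) (ν i) v x))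
      (fun i => (measurable_gaussianRatio _ _ _).ennreal_ofReal)
      fun i => gaussianReal_eq_withDensity _ _ hv
  · have h : (fun x : ι → ℝ => ENNReal.ofReal ((∏ i, gaussianRatio (μ i) (ν i) v (x i)) ^ 2))
        = fun x => ∏ i, ENNReal.ofReal (gaussianRatio (μ i) (ν i) v (x i) ^ 2) := by
      funext x
      rw [← Finset.prod_pow, ENNReal.ofReal_prod_of_nonneg fun i _ => sq_nonneg _]
    rw [h, lintegral_pi_prod _ (fun i x => ENNReal.ofReal (gaussianRatio (μ i) (ν i) v x ^ 2))
      fun i => ((measurable_gaussianRatio _ _ _).pow_const 2).ennreal_ofReal, Real.exp_sum,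
      ENNReal.ofReal_prod_of_nonneg fun i _ => (Real.exp_pos _).le]
    exact (Finset.prod_congr rfl fun i _ => lintegral_gaussianRatio_sq _ _ hv).le

/-! ### Bernoulli sampling and the risk at one entry -/

section Bernoulli

variable {n₁ n₂ n₃ : ℕ}

/-- Expand `∏ (γ + c i)` with `c p = 0` and `c i = 1 - γ` otherwise: only the sets containing `p`
survive, and every factor except the one at `p` equals one. -/
theorem sum_bernoulli_weight_mem {ι : Type*} [Fintype ι] [DecidableEq ι] (γ : ℝ) (p : ι) :
    ∑ Ω : Finset ι, (if p ∈ Ω then γ ^ Ω.card * (1 - γ) ^ Ωᶜ.card else 0) = γ := by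
  have h := Finset.prod_add (fun _ : ι => γ) (fun i => if i = p then 0 else 1 - γ) Finset.univ
  have hl : ∏ i : ι, (γ + if i = p then 0 else 1 - γ) = γ := by
    rw [Finset.prod_eq_single p (fun i _ hi => by simp [hi]) (by simp)]
    simp
  rw [hl, Finset.powerset_univ] at h
  refine Eq.symm (h.trans (Finset.sum_congr rfl fun Ω _ => ?_))
  rw [Finset.prod_const, ← Finset.compl_eq_univ_sdiff]
  split_ifs with hp
  · congr 1
    rw [Finset.prod_congr rfl (g := fun _ => 1 - γ), Finset.prod_const]
    rintro i hi
    rw [if_neg]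
    rintro rfl
    exact Finset.mem_compl.1 hi hp
  · rw [Finset.prod_eq_zero (Finset.mem_compl.2 hp) (by simp), mul_zero]

theorem sum_bernoulli_weight {ι : Type*} [Fintype ι] [DecidableEq ι] (γ : ℝ) :
    ∑ Ω : Finset ι, γ ^ Ω.card * (1 - γ) ^ Ωᶜ.card = 1 := by
  have h := Finset.prod_add (fun _ : ι => γ) (fun _ => 1 - γ) Finset.univ
  simp only [add_sub_cancel, Finset.prod_const_one, Finset.powerset_univ, Finset.prod_const,
    ← Finset.compl_eq_univ_sdiff] at h
  exact h.symm

theorem sum_bernoulli_weight_card_inter {ι : Type*} [Fintype ι] [DecidableEq ι] (γ : ℝ)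
    (F : Finset ι) :
    ∑ Ω : Finset ι, γ ^ Ω.card * (1 - γ) ^ Ωᶜ.card * ((Ω ∩ F).card : ℝ) = γ * F.card := by
  have : ∀ Ω : Finset ι, γ ^ Ω.card * (1 - γ) ^ Ωᶜ.card * ((Ω ∩ F).card : ℝ)
      = ∑ p ∈ F, if p ∈ Ω then γ ^ Ω.card * (1 - γ) ^ Ωᶜ.card else 0 := by
    intro Ω
    rw [← Finset.sum_filter, Finset.sum_const, nsmul_eq_mul, mul_comm, Finset.inter_comm,
      Finset.filter_mem_eq_inter]
  simp_rw [this]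
  rw [Finset.sum_comm, Finset.sum_congr rfl fun p _ => sum_bernoulli_weight_mem γ p,
    Finset.sum_const, nsmul_eq_mul, mul_comm]

/-- The risk at a single entry, without normalization. -/
noncomputable def entryRisk (γ σ : ℝ) (T : Estimator n₁ n₂ n₃) (X : Tensor n₁ n₂ n₃)
    (p : Idx n₁ n₂ n₃) : ℝ≥0∞ :=
  ∑ Ω : Finset (Idx n₁ n₂ n₃), bernWeight γ Ω *
    ∫⁻ y, ENNReal.ofReal ((T.est Ω y p.1 p.2.1 p.2.2 - X p.1 p.2.1 p.2.2) ^ 2) ∂(gaussianObs σ X Ω)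

theorem measurable_est_entry (T : Estimator n₁ n₂ n₃) (Ω : Finset (Idx n₁ n₂ n₃))
    (p : Idx n₁ n₂ n₃) : Measurable fun y => T.est Ω y p.1 p.2.1 p.2.2 := by
  have := T.measurable_est Ω
  fun_prop

theorem risk_eq_sum_entryRisk (m : ℕ) (σ : ℝ) (T : Estimator n₁ n₂ n₃) (X : Tensor n₁ n₂ n₃) :
    risk m σ T X = (∑ p, entryRisk ((m : ℝ) / ((n₁ : ℝ) * n₂ * n₃)) σ T X p) /
      ((n₁ : ℝ≥0∞) * n₂ * n₃) := by
  unfold risk entryRisk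
  congr 1
  rw [Finset.sum_comm]
  refine Finset.sum_congr rfl fun Ω _ => ?_
  rw [← Finset.mul_sum, ← lintegral_finsetSum]
  · congr 1
    refine lintegral_congr fun y => ?_
    rw [frobNorm, Real.sq_sqrt (by positivity), ← ENNReal.ofReal_sum_of_nonneg
      fun _ _ => sq_nonneg _]
    simp only [Fintype.sum_prod_type, Pi.sub_apply]
  · intro p _
    exact ((measurable_est_entry T Ω p).sub_const _).pow_const 2 |>.ennreal_ofReal

/-- Two tensors that differ by at most `h`, and only on `F`, cannot both be estimated well at an
entry where they differ by exactly `h`. -/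
theorem entryRisk_two_point {γ σ h : ℝ} (hγ0 : 0 ≤ γ) (hγ1 : γ ≤ 1) (hσ : 0 < σ)
    (T : Estimator n₁ n₂ n₃) (X Y : Tensor n₁ n₂ n₃) (F : Finset (Idx n₁ n₂ n₃))
    (hF : ∀ q, (Y q.1 q.2.1 q.2.2 - X q.1 q.2.1 q.2.2) ^ 2 ≤ if q ∈ F then h ^ 2 else 0)
    (p : Idx n₁ n₂ n₃) (hp : (X p.1 p.2.1 p.2.2 - Y p.1 p.2.1 p.2.2) ^ 2 = h ^ 2)
    (hsmall : 2 * γ * h ^ 2 * F.card ≤ σ ^ 2) :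
    ENNReal.ofReal (h ^ 2 / 4) ≤ entryRisk γ σ T X p + entryRisk γ σ T Y p := by
  have hσ2 : 0 < σ ^ 2 := by positivity
  have hv : Real.toNNReal (σ ^ 2) ≠ 0 := by simpa using hσ.ne'
  have hw : ∀ Ω : Finset (Idx n₁ n₂ n₃), 0 ≤ γ ^ Ω.card * (1 - γ) ^ Ωᶜ.card := fun Ω =>
    mul_nonneg (pow_nonneg hγ0 _) (pow_nonneg (by linarith) _)
  have hone : ∀ Ω : Finset (Idx n₁ n₂ n₃),
      ENNReal.ofReal (h ^ 2 * (1 - (Ω ∩ F).card * (h ^ 2 / σ ^ 2)) / 2) ≤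
      ∫⁻ y, ENNReal.ofReal ((T.est Ω y p.1 p.2.1 p.2.2 - X p.1 p.2.1 p.2.2) ^ 2)
        ∂(gaussianObs σ X Ω) +
      ∫⁻ y, ENNReal.ofReal ((T.est Ω y p.1 p.2.1 p.2.2 - Y p.1 p.2.1 p.2.2) ^ 2)
        ∂(gaussianObs σ Y Ω) := by
    intro Ω
    refine le_trans (ENNReal.ofReal_le_ofReal ?_)
      (pi_gaussian_two_point (fun q : Ω => X q.1.1 q.1.2.1 q.1.2.2)
        (fun q : Ω => Y q.1.1 q.1.2.1 q.1.2.2) hv _ (measurable_est_entry T Ω p) _ _)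
    rw [hp, Real.coe_toNNReal _ hσ2.le]
    have : ∑ q : Ω, (Y q.1.1 q.1.2.1 q.1.2.2 - X q.1.1 q.1.2.1 q.1.2.2) ^ 2 / σ ^ 2
        ≤ (Ω ∩ F).card * (h ^ 2 / σ ^ 2) := by
      calc _ ≤ ∑ q : Ω, (if q.1 ∈ F then h ^ 2 else 0) / σ ^ 2 := by
            gcongr with q; exact hF q.1
        _ = ∑ q ∈ Ω, (if q ∈ F then h ^ 2 else 0) / σ ^ 2 :=
            Finset.sum_coe_sort Ω fun q => (if q ∈ F then h ^ 2 else 0) / σ ^ 2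
        _ = _ := by
            simp_rw [ite_div, zero_div]
            rw [← Finset.sum_filter, Finset.sum_const, nsmul_eq_mul, Finset.filter_mem_eq_inter]
    gcongr
  unfold entryRisk
  rw [← Finset.sum_add_distrib]
  calc ENNReal.ofReal (h ^ 2 / 4)
      ≤ ENNReal.ofReal (∑ Ω : Finset (Idx n₁ n₂ n₃), γ ^ Ω.card * (1 - γ) ^ Ωᶜ.card *
          (h ^ 2 * (1 - (Ω ∩ F).card * (h ^ 2 / σ ^ 2)) / 2)) := by
        refine ENNReal.ofReal_le_ofReal ?_
        have : ∑ Ω : Finset (Idx n₁ n₂ n₃), γ ^ Ω.card * (1 - γ) ^ Ωᶜ.card *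
            (h ^ 2 * (1 - (Ω ∩ F).card * (h ^ 2 / σ ^ 2)) / 2)
            = h ^ 2 / 2 * (∑ Ω : Finset (Idx n₁ n₂ n₃), γ ^ Ω.card * (1 - γ) ^ Ωᶜ.card)
              - h ^ 2 / 2 * (h ^ 2 / σ ^ 2) * ∑ Ω : Finset (Idx n₁ n₂ n₃),
                γ ^ Ω.card * (1 - γ) ^ Ωᶜ.card * ((Ω ∩ F).card : ℝ) := by
          rw [Finset.mul_sum, Finset.mul_sum, ← Finset.sum_sub_distrib]
          exact Finset.sum_congr rfl fun Ω _ => by ring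
        rw [this, sum_bernoulli_weight, sum_bernoulli_weight_card_inter]
        -- The expected exponent over `Ω` is at most `1 / 2`, which leaves `h² / 2 * (1 - 1 / 2) =
        -- h² / 4`.
        have h2 : h ^ 2 / σ ^ 2 * (γ * F.card) ≤ 1 / 2 := by
          rw [div_mul_eq_mul_div, div_le_iff₀ hσ2]; linarith
        nlinarith [mul_le_mul_of_nonneg_left h2 (by positivity : 0 ≤ h ^ 2 / 2)]
    -- The terms may be negative when `Ω ∩ F` is large, so only subadditivity of `ENNReal.ofReal` is
    -- available; truncating at zero goes in the right direction.
    _ ≤ ∑ Ω : Finset (Idx n₁ n₂ n₃), ENNReal.ofReal (γ ^ Ω.card * (1 - γ) ^ Ωᶜ.card *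
          (h ^ 2 * (1 - (Ω ∩ F).card * (h ^ 2 / σ ^ 2)) / 2)) :=
        Finset.le_sum_of_subadditive _ ENNReal.ofReal_zero.le (fun _ _ => ENNReal.ofReal_add_le) _ _
    _ ≤ _ := by
        refine Finset.sum_le_sum fun Ω _ => ?_
        rw [← mul_add, ENNReal.ofReal_mul (hw Ω), bernWeight]
        gcongr
        exact hone Ω

end Bernoulli

/-! ### Assouad's lemma for cubes of tensors -/

section Hypercube

variable {n₁ n₂ n₃ : ℕ} {D : Type*}

/-- The tensor whose entry at `p` is `h` if `p` is controlled by a parameter that is switched on,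
and `0` otherwise. -/
def cubeTensor (φ : Idx n₁ n₂ n₃ → Option D) (h : ℝ) (θ : D → Bool) : Tensor n₁ n₂ n₃ :=
  fun i j k => if (φ (i, j, k)).any θ then h else 0

/-- The total risk over the two tensors that differ in the parameter that controls the entry. -/
theorem entryRisk_cubeTensor_pair [DecidableEq D] {γ σ h : ℝ} (hγ0 : 0 ≤ γ) (hγ1 : γ ≤ 1)
    (hσ : 0 < σ) (T : Estimator n₁ n₂ n₃) (φ : Idx n₁ n₂ n₃ → Option D) (N : ℝ)
    (hN : ∀ d, ((Finset.univ.filter fun p => φ p = some d).card : ℝ) ≤ N)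
    (hsmall : 2 * γ * h ^ 2 * N ≤ σ ^ 2) (p : Idx n₁ n₂ n₃) (d : D) (hp : φ p = some d)
    (θ : D → Bool) :
    ENNReal.ofReal (h ^ 2 / 4) ≤ entryRisk γ σ T (cubeTensor φ h θ) p +
      entryRisk γ σ T (cubeTensor φ h (Function.update θ d (!θ d))) p := by
  refine entryRisk_two_point hγ0 hγ1 hσ T _ _ (Finset.univ.filter fun p => φ p = some d) ?_ p ?_ ?_
  · intro q
    simp only [cubeTensor, Finset.mem_filter, Finset.mem_univ, true_and, Prod.mk.eta]
    rcases hq : φ q with _ | e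
    · simp
    · by_cases he : e = d
      · subst he
        cases hθ : θ e <;> simp [hθ]
      · simp [he]
  · simp only [cubeTensor, Prod.mk.eta, hp]
    cases hθ : θ d <;> simp [hθ]
  · exact (mul_le_mul_of_nonneg_left (hN d) (by positivity)).trans hsmall

/-- Assouad's lower bound for the risk over a class that contains a hypercube of tensors. -/
theorem iSup_risk_ge_of_cube [Fintype D] [DecidableEq D] {m : ℕ} {σ h : ℝ}
    (hn : 0 < n₁ * n₂ * n₃) (hm : m ≤ n₁ * n₂ * n₃)
    (hσ : 0 < σ) (T : Estimator n₁ n₂ n₃) (S : Set (Tensor n₁ n₂ n₃))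
    (φ : Idx n₁ n₂ n₃ → Option D) (N : ℝ)
    (hN : ∀ d, ((Finset.univ.filter fun p => φ p = some d).card : ℝ) ≤ N)
    (hsmall : 2 * ((m : ℝ) / ((n₁ : ℝ) * n₂ * n₃)) * h ^ 2 * N ≤ σ ^ 2)
    (hS : ∀ θ, cubeTensor φ h θ ∈ S) :
    ENNReal.ofReal ((Finset.univ.filter fun p => (φ p).isSome).card * h ^ 2 /
      (8 * ((n₁ : ℝ) * n₂ * n₃))) ≤ ⨆ X ∈ S, risk m σ T X := by
  have hn' : (0 : ℝ) < (n₁ : ℝ) * n₂ * n₃ := by exact_mod_cast hn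
  set γ := (m : ℝ) / ((n₁ : ℝ) * n₂ * n₃) with hγ
  have hγ0 : 0 ≤ γ := by positivity
  have hγ1 : γ ≤ 1 := by
    rw [hγ, div_le_one hn']; exact_mod_cast hm
  set dom := Finset.univ.filter fun p => (φ p).isSome with hdom
  set R := ⨆ X ∈ S, risk m σ T X with hR
  set V : ℝ≥0∞ := (n₁ : ℝ≥0∞) * n₂ * n₃ with hV
  have hVr : V = ENNReal.ofReal ((n₁ : ℝ) * n₂ * n₃) := by
    rw [hV, ENNReal.ofReal_mul (by positivity), ENNReal.ofReal_mul (by positivity)]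
    simp
  have hV0 : V ≠ 0 := by rw [hVr]; simpa using hn'
  have hVT : V ≠ ⊤ := by rw [hVr]; exact ENNReal.ofReal_ne_top
  have hle : ∀ θ, ∑ p ∈ dom, entryRisk γ σ T (cubeTensor φ h θ) p ≤ R * V := by
    intro θ
    have h1 : risk m σ T (cubeTensor φ h θ) ≤ R := le_iSup₂_of_le _ (hS θ) le_rfl
    rw [risk_eq_sum_entryRisk, ENNReal.div_le_iff hV0 hVT] at h1
    exact (Finset.sum_le_sum_of_subset (Finset.subset_univ _)).trans h1
  have hpair : ∀ p ∈ dom, (Fintype.card (D → Bool) : ℝ≥0∞) * ENNReal.ofReal (h ^ 2 / 4)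
      ≤ 2 * ∑ θ, entryRisk γ σ T (cubeTensor φ h θ) p := by
    intro p hp
    obtain ⟨d, hd⟩ := Option.isSome_iff_exists.1 (Finset.mem_filter.1 hp).2
    -- Flipping bit `d` permutes the cube, so summing the pair bound over all `θ` counts each vertex
    -- exactly twice.
    have hinv : Function.Involutive fun θ : D → Bool => Function.update θ d (!θ d) := by
      intro θ; simp
    have hswap : ∑ θ, entryRisk γ σ T (cubeTensor φ h (Function.update θ d (!θ d))) p
        = ∑ θ, entryRisk γ σ T (cubeTensor φ h θ) p :=
      Equiv.sum_comp hinv.toPerm fun θ => entryRisk γ σ T (cubeTensor φ h θ) p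
    calc (Fintype.card (D → Bool) : ℝ≥0∞) * ENNReal.ofReal (h ^ 2 / 4)
        = ∑ _θ : D → Bool, ENNReal.ofReal (h ^ 2 / 4) := by
          rw [Finset.sum_const, nsmul_eq_mul, Finset.card_univ]
      _ ≤ ∑ θ, (entryRisk γ σ T (cubeTensor φ h θ) p +
            entryRisk γ σ T (cubeTensor φ h (Function.update θ d (!θ d))) p) :=
          Finset.sum_le_sum fun θ _ =>
            entryRisk_cubeTensor_pair hγ0 hγ1 hσ T φ N hN hsmall p d hd θ
      _ = _ := by rw [Finset.sum_add_distrib, hswap, two_mul]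
  have htot : (Fintype.card (D → Bool) : ℝ≥0∞) * (dom.card * ENNReal.ofReal (h ^ 2 / 4))
      ≤ (Fintype.card (D → Bool) : ℝ≥0∞) * (2 * (R * V)) := by
    calc (Fintype.card (D → Bool) : ℝ≥0∞) * (dom.card * ENNReal.ofReal (h ^ 2 / 4))
        = ∑ p ∈ dom, (Fintype.card (D → Bool) : ℝ≥0∞) * ENNReal.ofReal (h ^ 2 / 4) := by
          rw [Finset.sum_const, nsmul_eq_mul]; ring
      _ ≤ ∑ p ∈ dom, 2 * ∑ θ, entryRisk γ σ T (cubeTensor φ h θ) p := Finset.sum_le_sum hpair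
      _ = 2 * ∑ θ, ∑ p ∈ dom, entryRisk γ σ T (cubeTensor φ h θ) p := by
          rw [← Finset.mul_sum, Finset.sum_comm]
      _ ≤ 2 * ∑ _θ : D → Bool, R * V := by
          gcongr with θ
          exact hle θ
      _ = _ := by rw [Finset.sum_const, nsmul_eq_mul, Finset.card_univ]; ring
  rw [ENNReal.mul_le_mul_iff_right (by simp) (by simp)] at htot
  have h8 : ENNReal.ofReal (dom.card * h ^ 2 / (8 * ((n₁ : ℝ) * n₂ * n₃)))
      = dom.card * ENNReal.ofReal (h ^ 2 / 4) / (2 * V) := by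
    rw [hVr, ← ENNReal.ofReal_natCast, ← ENNReal.ofReal_mul (by positivity),
      ← ENNReal.ofReal_ofNat, ← ENNReal.ofReal_mul (by positivity),
      ← ENNReal.ofReal_div_of_pos (by positivity)]
    congr 1
    field_simp
    ring
  rw [h8, ENNReal.div_le_iff (by simp [hV0]) (ENNReal.mul_ne_top (by simp) hVT)]
  calc _ ≤ _ := htot
    _ = _ := by ring

end Hypercube

/-! ### The two hypercubes inside the class -/

section Constructions

variable {n₁ n₂ n₃ r s : ℕ}

theorem tensorProd_apply (A : Tensor n₁ r n₃) (B : Tensor r n₂ n₃) (i : Fin n₁) (j : Fin n₂)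
    (k : Fin n₃) : tensorProd A B i j k = ∑ l, ∑ q, A i q (k - l) * B q j l := by
  simp [tensorProd, fold, circ, unfold, Matrix.mul_apply, Fintype.sum_prod_type]

theorem cubeTensor_nonneg {D : Type*} (φ : Idx n₁ n₂ n₃ → Option D) {h : ℝ} (hh : 0 ≤ h)
    (θ : D → Bool) (i : Fin n₁) (j : Fin n₂) (k : Fin n₃) : 0 ≤ cubeTensor φ h θ i j k := by
  unfold cubeTensor; split_ifs <;> simp [hh]

/-- Every column `j < r * N` is a copy of the column `j % r` of the left factor. -/
def leftIndex (hr : 0 < r) (N : ℕ) (p : Idx n₁ n₂ n₃) : Option (Fin n₁ × Fin r × Fin n₃) :=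
  if p.2.1.val < r * N then some (p.1, ⟨p.2.1 % r, Nat.mod_lt _ hr⟩, p.2.2) else none

/-- `A` carries the bits, scaled to `h / b ≤ 1`. `B` lives in slice `0`, so the circular convolution
collapses to a slicewise product; it has a single entry `b` in each column `j < r * N`, hence at
most `s` nonzero entries. -/
theorem cubeTensor_leftIndex_mem [NeZero n₃] (hr : 0 < r) {N : ℕ} (hNs : r * N ≤ s) {b h : ℝ}
    (hb : 0 < b) (hh : 0 ≤ h) (hhb : h ≤ b) (θ : Fin n₁ × Fin r × Fin n₃ → Bool) :
    cubeTensor (leftIndex (n₂ := n₂) hr N) h θ ∈ candidateSet n₁ n₂ n₃ r b s := by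
  refine ⟨cubeTensor_nonneg _ hh θ, fun i q k => if θ (i, q, k) then h / b else 0,
    fun q j l => if l = 0 ∧ j.val < r * N ∧ j.val % r = q.val then b else 0, ?_, ?_, ?_, ?_⟩
  · ext i j k
    rw [tensorProd_apply, Finset.sum_eq_single 0 (fun l _ hl => by simp [hl]) (by simp),
      Finset.sum_eq_single ⟨j % r, Nat.mod_lt _ hr⟩]
    · unfold cubeTensor leftIndex
      by_cases hj : j.val < r * N
      · by_cases ht : θ (i, ⟨j % r, Nat.mod_lt _ hr⟩, k)
        · simp [hj, ht, div_mul_cancel₀ h hb.ne']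
        · simp [hj, ht]
      · simp [hj]
    · intro q _ hq
      rw [if_neg (c := (0 : Fin n₃) = 0 ∧ _), mul_zero]
      rintro ⟨-, -, h3⟩
      exact hq (Fin.ext h3.symm)
    · simp
  · intro i q k
    dsimp only
    split_ifs
    · exact ⟨by positivity, (div_le_one hb).2 hhb⟩
    · simp
  · intro q j l
    dsimp only
    split_ifs
    · exact ⟨hb.le, le_rfl⟩
    · exact ⟨le_rfl, hb.le⟩
  · refine le_trans ?_ hNs
    refine le_trans ?_
      ((Set.ncard_coe_finset (Finset.range (r * N))).trans (Finset.card_range _)).le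
    rw [l0Norm]
    have hne : ∀ p ∈ {p : Idx r n₂ n₃ |
        (if p.2.2 = 0 ∧ p.2.1.val < r * N ∧ p.2.1.val % r = p.1.val then b else 0) ≠ 0},
        p.2.2 = 0 ∧ p.2.1.val < r * N ∧ p.2.1.val % r = p.1.val := by
      intro p hp
      by_contra hc
      exact hp (if_neg hc)
    refine Set.ncard_le_ncard_of_injOn (fun p => p.2.1.val) ?_ ?_ (Finset.finite_toSet _)
    · intro p hp
      simpa using (hne p hp).2.1
    · rintro ⟨q, j, l⟩ hp ⟨q', j', l'⟩ hp' (heq : j.val = j'.val)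
      obtain ⟨h1, -, h3⟩ := hne _ hp
      obtain ⟨h1', -, h3'⟩ := hne _ hp'
      simp only at h1 h3 h1' h3'
      refine Prod.ext (Fin.ext ?_) (Prod.ext (Fin.ext heq) (h1.trans h1'.symm))
      rw [← h3, ← h3', heq]

/-- The parameter fixes the row, the slice and `j % r`, so a position in the fiber is determined by
the quotient `j / r < N`. -/
theorem card_leftIndex_fiber_le (hr : 0 < r) (N : ℕ) (d : Fin n₁ × Fin r × Fin n₃) :
    (Finset.univ.filter fun p : Idx n₁ n₂ n₃ => leftIndex hr N p = some d).card ≤ N := by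
  refine le_trans ?_ (Finset.card_range N).le
  have hmem : ∀ p ∈ Finset.univ.filter fun p : Idx n₁ n₂ n₃ => leftIndex hr N p = some d,
      p.2.1.val < r * N ∧ (p.1, (⟨p.2.1 % r, Nat.mod_lt _ hr⟩ : Fin r), p.2.2) = d := by
    intro p hp
    have hp := (Finset.mem_filter.1 hp).2
    unfold leftIndex at hp
    split_ifs at hp with hj
    exact ⟨hj, Option.some_injective _ hp⟩
  refine Finset.card_le_card_of_injOn (fun p => p.2.1.val / r) ?_ ?_
  · intro p hp
    simpa using Nat.div_lt_of_lt_mul (hmem p hp).1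
  · rintro ⟨i, j, k⟩ hp ⟨i', j', k'⟩ hp' (heq : j.val / r = j'.val / r)
    have h := (hmem _ hp).2.trans (hmem _ hp').2.symm
    simp only [Prod.mk.injEq, Fin.mk.injEq] at h
    obtain ⟨h1, h2, h3⟩ := h
    refine Prod.ext h1 (Prod.ext (Fin.ext ?_) h3)
    change j.val = j'.val
    rw [← Nat.div_add_mod j.val r, ← Nat.div_add_mod j'.val r, heq, h2]

theorem le_card_leftIndex_isSome (hr : 0 < r) {N : ℕ} (hN : r * N ≤ n₂) :
    n₁ * (r * N) * n₃ ≤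
      (Finset.univ.filter fun p : Idx n₁ n₂ n₃ => (leftIndex hr N p).isSome).card := by
  have hc : n₁ * (r * N) * n₃ = (Finset.univ : Finset (Fin n₁ × Fin (r * N) × Fin n₃)).card := by
    simp [mul_assoc]
  rw [hc]
  refine Finset.card_le_card_of_injOn (fun p => (p.1, Fin.castLE hN p.2.1, p.2.2)) ?_ ?_
  · intro p _
    simp [leftIndex]
  · rintro ⟨i, j, k⟩ _ ⟨i', j', k'⟩ _ heq
    simpa using heq

/-- Every row `i < r' * M` is a copy of the row `i % r'` of the right factor, restricted to its
support `S`. -/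
def rightIndex {r' : ℕ} (hr : 0 < r') (hr' : r' ≤ r) (M : ℕ) (S : Finset (Idx r n₂ n₃))
    (p : Idx n₁ n₂ n₃) : Option (Idx r n₂ n₃) :=
  if p.1.val < r' * M ∧ (⟨p.1 % r', (Nat.mod_lt _ hr).trans_le hr'⟩, p.2.1, p.2.2) ∈ S then
    some (⟨p.1 % r', (Nat.mod_lt _ hr).trans_le hr'⟩, p.2.1, p.2.2) else none

/-- Here `A` is the 0-1 row selector in slice `0`, so only `l = k` contributes to the convolution,
and `B` carries the bits at height `h` on `S`. No division by `b` occurs, so `b = 0` is allowed. -/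
theorem cubeTensor_rightIndex_mem [NeZero n₃] {r' : ℕ} (hr : 0 < r') (hr' : r' ≤ r) (M : ℕ)
    (S : Finset (Idx r n₂ n₃)) (hS : S.card ≤ s) {b h : ℝ}
    (hh : 0 ≤ h) (hhb : h ≤ b) (θ : Idx r n₂ n₃ → Bool) :
    cubeTensor (rightIndex (n₁ := n₁) hr hr' M S) h θ ∈ candidateSet n₁ n₂ n₃ r b s := by
  refine ⟨cubeTensor_nonneg _ hh θ,
    fun i q k => if k = 0 ∧ i.val < r' * M ∧ i.val % r' = q.val then 1 else 0,
    fun q j l => if (q, j, l) ∈ S ∧ θ (q, j, l) then h else 0, ?_, ?_, ?_, ?_⟩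
  · ext i j k
    rw [tensorProd_apply, Finset.sum_eq_single k
      (fun l _ hl => by simp [sub_eq_zero, Ne.symm hl]) (by simp),
      Finset.sum_eq_single ⟨i % r', (Nat.mod_lt _ hr).trans_le hr'⟩]
    · unfold cubeTensor rightIndex
      by_cases hi : i.val < r' * M
      · by_cases hm : ((⟨i % r', (Nat.mod_lt _ hr).trans_le hr'⟩ : Fin r), j, k) ∈ S
        · simp [hi, hm]
        · simp [hm]
      · simp [hi]
    · intro q _ hq
      rw [if_neg (c := k - k = 0 ∧ _), zero_mul]
      rintro ⟨-, -, h3⟩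
      exact hq (Fin.ext h3.symm)
    · simp
  · intro i q k
    dsimp only
    split_ifs <;> simp
  · intro q j l
    dsimp only
    split_ifs
    · exact ⟨hh, hhb⟩
    · exact ⟨le_rfl, hh.trans hhb⟩
  · refine le_trans ?_ hS
    rw [l0Norm, ← Set.ncard_coe_finset S]
    refine Set.ncard_le_ncard ?_ (Finset.finite_toSet _)
    intro p hp
    by_contra hc
    exact hp (if_neg fun h => hc h.1)

theorem card_rightIndex_fiber_le {r' : ℕ} (hr : 0 < r') (hr' : r' ≤ r) (M : ℕ)
    (S : Finset (Idx r n₂ n₃)) (d : Idx r n₂ n₃) :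
    (Finset.univ.filter fun p : Idx n₁ n₂ n₃ => rightIndex hr hr' M S p = some d).card ≤ M := by
  refine le_trans ?_ (Finset.card_range M).le
  have hmem : ∀ p ∈ Finset.univ.filter fun p : Idx n₁ n₂ n₃ => rightIndex hr hr' M S p = some d,
      p.1.val < r' * M ∧
        ((⟨p.1 % r', (Nat.mod_lt _ hr).trans_le hr'⟩ : Fin r), p.2.1, p.2.2) = d := by
    intro p hp
    have hp := (Finset.mem_filter.1 hp).2
    unfold rightIndex at hp
    split_ifs at hp with hj
    exact ⟨hj.1, Option.some_injective _ hp⟩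
  refine Finset.card_le_card_of_injOn (fun p => p.1.val / r') ?_ ?_
  · intro p hp
    simpa using Nat.div_lt_of_lt_mul (hmem p hp).1
  · rintro ⟨i, j, k⟩ hp ⟨i', j', k'⟩ hp' (heq : i.val / r' = i'.val / r')
    have h := (hmem _ hp).2.trans (hmem _ hp').2.symm
    simp only [Prod.mk.injEq, Fin.mk.injEq] at h
    obtain ⟨h1, h2, h3⟩ := h
    refine Prod.ext (Fin.ext ?_) (Prod.ext h2 h3)
    change i.val = i'.val
    rw [← Nat.div_add_mod i.val r', ← Nat.div_add_mod i'.val r', heq, h1]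

theorem le_card_rightIndex_isSome {r' : ℕ} (hr : 0 < r') (hr' : r' ≤ r) {M : ℕ}
    (hM : r' * M ≤ n₁) (S : Finset (Idx r n₂ n₃)) (hS : ∀ q ∈ S, q.1.val < r') :
    S.card * M ≤
      (Finset.univ.filter fun p : Idx n₁ n₂ n₃ => (rightIndex hr hr' M S p).isSome).card := by
  have hlt : ∀ (q : S) (t : Fin M), q.1.1.val + r' * t.val < r' * M := by
    intro q t
    calc q.1.1.val + r' * t.val < r' + r' * t.val := by
          have := hS q.1 q.2; omega
      _ = r' * (t.val + 1) := by ring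
      _ ≤ r' * M := Nat.mul_le_mul_left _ t.2
  have hc : S.card * M = (Finset.univ : Finset (S × Fin M)).card := by simp
  rw [hc]
  refine Finset.card_le_card_of_injOn
    (fun x => (⟨x.1.1.1.val + r' * x.2.val, (hlt x.1 x.2).trans_le hM⟩, x.1.1.2.1, x.1.1.2.2))
    ?_ ?_
  · rintro ⟨q, t⟩ _
    have hmod : (q.1.1.val + r' * t.val) % r' = q.1.1.val := by
      rw [Nat.add_mul_mod_self_left, Nat.mod_eq_of_lt (hS q.1 q.2)]
    simp [rightIndex, hlt q t, hmod]
  · rintro ⟨⟨⟨q, j, k⟩, hq⟩, t⟩ _ ⟨⟨⟨q', j', k'⟩, hq'⟩, t'⟩ _ heq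
    simp only [Prod.mk.injEq, Fin.mk.injEq] at heq
    obtain ⟨h1, h2, h3⟩ := heq
    have hlq : q.val < r' := hS _ hq
    have hlq' : q'.val < r' := hS _ hq'
    have hqq : q.val = q'.val := by
      have := congrArg (· % r') h1
      simpa [Nat.add_mul_mod_self_left, Nat.mod_eq_of_lt hlq, Nat.mod_eq_of_lt hlq'] using this
    have htt : t.val = t'.val := by
      rw [hqq] at h1
      exact Nat.eq_of_mul_eq_mul_left hr (Nat.add_left_cancel h1)
    obtain rfl := Fin.ext hqq
    obtain rfl := Fin.ext htt
    subst h2 h3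
    rfl

theorem exists_support_of_card {r' : ℕ} (hr' : r' ≤ r) (hs : s ≤ r' * n₂ * n₃) :
    ∃ S : Finset (Idx r n₂ n₃), S.card = s ∧ ∀ q ∈ S, q.1.val < r' := by
  have hc : s ≤ (Finset.univ.map ⟨fun p : Fin r' × Fin n₂ × Fin n₃ =>
      ((Fin.castLE hr' p.1, p.2) : Idx r n₂ n₃), by
        rintro ⟨i, p⟩ ⟨i', p'⟩ h
        simpa using h⟩).card := by
    simpa [mul_assoc] using hs
  obtain ⟨S, hS, hcard⟩ := Finset.exists_subset_card_eq hc
  refine ⟨S, hcard, fun q hq => ?_⟩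
  obtain ⟨p, -, rfl⟩ := Finset.mem_map.1 (hS hq)
  exact p.1.2

end Constructions

/-! ### Choice of amplitude and the resulting rates -/

section Rates

variable {n₁ n₂ n₃ r s m : ℕ} {b σ : ℝ}

/-- Take `h = min b (σ / √x)`; the final alternative records which constraint is active. -/
theorem exists_amplitude {b σ x : ℝ} (hb : 0 ≤ b) (hσ : 0 ≤ σ) (hx : 0 < x) :
    ∃ h, 0 ≤ h ∧ h ≤ b ∧ x * h ^ 2 ≤ σ ^ 2 ∧ (h ^ 2 = b ^ 2 ∨ h ^ 2 = σ ^ 2 / x) := by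
  have hsq : (σ / √x) ^ 2 = σ ^ 2 / x := by rw [div_pow, Real.sq_sqrt hx.le]
  rcases le_total b (σ / √x) with hle | hle
  · refine ⟨b, hb, le_rfl, ?_, Or.inl rfl⟩
    have := pow_le_pow_left₀ hb hle 2
    rwa [hsq, le_div_iff₀ hx, mul_comm] at this
  · exact ⟨σ / √x, by positivity, hle, by rw [hsq, mul_div_cancel₀ _ hx.ne'], Or.inr hsq⟩

/-- The part of the lower bound that is due to the unknown left factor. -/
theorem iSup_risk_ge_left (h1 : 0 < n₁) (h2 : 0 < n₂) (h3 : 0 < n₃) (hm0 : 0 < m)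
    (hm : m ≤ n₁ * n₂ * n₃) (hb : 0 < b) (hσ : 0 < σ) (hr : 0 < r) (hrn : r ≤ n₂) (hrs : r ≤ s)
    (T : Estimator n₁ n₂ n₃) :
    ENNReal.ofReal (min (Delta n₂ n₃ s * b ^ 2) (σ ^ 2 * (r * n₁ * n₃ / m)) / 32) ≤
      ⨆ X ∈ candidateSet n₁ n₂ n₃ r b s, risk m σ T X := by
  have : NeZero n₃ := ⟨h3.ne'⟩
  -- Number of copies of each column of `A`: `r * N` may exceed neither the sparsity budget `s` nor
  -- the `n₂` columns. As `r ≤ min s n₂`, rounding down loses at most a factor of two.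
  set N := min s n₂ / r with hN
  have hN0 : 0 < N := Nat.div_pos (le_min hrs hrn) hr
  have hle : r * N ≤ min s n₂ := Nat.mul_div_le _ _
  have hge : min s n₂ ≤ 2 * (r * N) := by
    have h := Nat.lt_mul_div_succ (min s n₂) hr
    rw [← hN, mul_add, mul_one] at h
    have : r ≤ r * N := Nat.le_mul_of_pos_right _ hN0
    omega
  have h1' : (0 : ℝ) < n₁ := by exact_mod_cast h1
  have h2' : (0 : ℝ) < n₂ := by exact_mod_cast h2
  have h3' : (0 : ℝ) < n₃ := by exact_mod_cast h3
  have hm' : (0 : ℝ) < m := by exact_mod_cast hm0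
  have hN' : (0 : ℝ) < N := by exact_mod_cast hN0
  have hr' : (0 : ℝ) < r := by exact_mod_cast hr
  obtain ⟨h, hh0, hhb, hsmall, hh⟩ := exists_amplitude (x := 2 * (m / (n₁ * n₂ * n₃)) * N)
    hb.le hσ.le (by positivity)
  refine le_trans (ENNReal.ofReal_le_ofReal ?_) (iSup_risk_ge_of_cube (h := h)
    (by positivity) hm hσ T _ (leftIndex hr N) N
    (fun d => by exact_mod_cast card_leftIndex_fiber_le hr N d) (by linarith)
    (cubeTensor_leftIndex_mem hr (hle.trans (min_le_left _ _)) hb hh0 hhb))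
  have hK : (n₁ * (r * N) * n₃ : ℝ) ≤ (Finset.univ.filter fun p : Idx n₁ n₂ n₃ =>
      (leftIndex hr N p).isSome).card := by
    exact_mod_cast le_card_leftIndex_isSome hr (hle.trans (min_le_right _ _))
  refine le_trans ?_ (div_le_div_of_nonneg_right
    (mul_le_mul_of_nonneg_right hK (sq_nonneg h)) (by positivity))
  have hD : Delta n₂ n₃ s * n₂ ≤ 2 * (r * N) := by
    have h31 : (1 : ℝ) ≤ n₃ := by exact_mod_cast h3
    have hge' : min (s : ℝ) n₂ ≤ 2 * (r * N) := by exact_mod_cast hge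
    refine le_trans (le_min ?_ ?_) hge'
    · calc Delta n₂ n₃ s * n₂ ≤ s / (n₂ * n₃) * n₂ := by
            gcongr; exact min_le_right _ _
        _ = s / n₃ := by field_simp
        _ ≤ s := div_le_self (by positivity) h31
    · calc Delta n₂ n₃ s * n₂ ≤ 1 * n₂ := by
            gcongr; exact min_le_left _ _
        _ = n₂ := one_mul _
  rcases hh with hh | hh
  · rw [hh]
    have : n₁ * (r * N) * n₃ * b ^ 2 / (8 * ((n₁ : ℝ) * n₂ * n₃)) = r * N / n₂ * b ^ 2 / 8 := by
      field_simp
    rw [this]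
    have h5 : Delta n₂ n₃ s ≤ 2 * (r * N / n₂) := by
      rw [← mul_div_assoc, le_div_iff₀ h2']; exact hD
    have h6 : Delta n₂ n₃ s * b ^ 2 ≤ 2 * (r * N / n₂) * b ^ 2 := by gcongr
    have h7 : 0 ≤ r * N / n₂ * b ^ 2 := by positivity
    linarith [min_le_left (Delta n₂ n₃ s * b ^ 2) (σ ^ 2 * (r * n₁ * n₃ / m))]
  -- When the noise constraint is active, `N` cancels: more copies mean more governed entries but a
  -- proportionally smaller `h²`.
  · rw [hh]
    have : n₁ * (r * N) * n₃ * (σ ^ 2 / (2 * (m / (n₁ * n₂ * n₃)) * N)) /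
        (8 * ((n₁ : ℝ) * n₂ * n₃)) = σ ^ 2 * (r * n₁ * n₃ / m) / 16 := by
      field_simp
      ring
    rw [this]
    have h7 : 0 ≤ σ ^ 2 * (r * n₁ * n₃ / m) := by positivity
    linarith [min_le_right (Delta n₂ n₃ s * b ^ 2) (σ ^ 2 * (r * n₁ * n₃ / m))]

/-- The part of the lower bound that is due to the unknown right factor. -/
theorem iSup_risk_ge_right (h1 : 0 < n₁) (h2 : 0 < n₂) (h3 : 0 < n₃) (hm0 : 0 < m)
    (hm : m ≤ n₁ * n₂ * n₃) (hb : 0 ≤ b) (hσ : 0 < σ) (hrn : r ≤ n₁) (hs : 0 < s)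
    (hsr : s ≤ r * n₂ * n₃) (T : Estimator n₁ n₂ n₃) :
    ENNReal.ofReal (min (Delta n₂ n₃ s * b ^ 2) (σ ^ 2 * (s / m)) / 32) ≤
      ⨆ X ∈ candidateSet n₁ n₂ n₃ r b s, risk m σ T X := by
  have : NeZero n₃ := ⟨h3.ne'⟩
  have hnn : 0 < n₂ * n₃ := Nat.mul_pos h2 h3
  -- This is `⌈s / (n₂ n₃)⌉`, the least number of rows of `B` with room for `s` entries. Using few
  -- rows allows each to be copied `n₁ / r'` times, so that a fraction of order `Δ` of all positions
  -- is governed even when `r` is large.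
  set r' := (s - 1) / (n₂ * n₃) + 1 with hr'
  have hr0 : 0 < r' := Nat.succ_pos _
  have hrr : r' ≤ r := by
    refine Nat.div_lt_of_lt_mul ?_
    have : r * n₂ * n₃ = n₂ * n₃ * r := by ring
    omega
  have hsr' : s ≤ r' * n₂ * n₃ := by
    have h := Nat.lt_mul_div_succ (s - 1) hnn
    rw [← hr'] at h
    have : r' * n₂ * n₃ = n₂ * n₃ * r' := by ring
    omega
  have hr's : n₂ * n₃ * r' ≤ n₂ * n₃ + s := by
    have h := Nat.mul_div_le (s - 1) (n₂ * n₃)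
    rw [hr', mul_add, mul_one]
    omega
  set M := n₁ / r' with hM
  have hM0 : 0 < M := Nat.div_pos (hrr.trans hrn) hr0
  have hle : r' * M ≤ n₁ := Nat.mul_div_le _ _
  have hge : n₁ ≤ 2 * (r' * M) := by
    have h := Nat.lt_mul_div_succ n₁ hr0
    rw [← hM, mul_add, mul_one] at h
    have : r' ≤ r' * M := Nat.le_mul_of_pos_right _ hM0
    omega
  obtain ⟨S, hSc, hSr⟩ := exists_support_of_card (n₂ := n₂) (n₃ := n₃) hrr hsr'
  have h1' : (0 : ℝ) < n₁ := by exact_mod_cast h1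
  have h2' : (0 : ℝ) < n₂ := by exact_mod_cast h2
  have h3' : (0 : ℝ) < n₃ := by exact_mod_cast h3
  have hm' : (0 : ℝ) < m := by exact_mod_cast hm0
  have hM' : (0 : ℝ) < M := by exact_mod_cast hM0
  obtain ⟨h, hh0, hhb, hsmall, hh⟩ := exists_amplitude (x := 2 * (m / (n₁ * n₂ * n₃)) * M)
    hb hσ.le (by positivity)
  refine le_trans (ENNReal.ofReal_le_ofReal ?_) (iSup_risk_ge_of_cube (h := h)
    (by positivity) hm hσ T _ (rightIndex hr0 hrr M S) M
    (fun d => by exact_mod_cast card_rightIndex_fiber_le hr0 hrr M S d) (by linarith)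
    (cubeTensor_rightIndex_mem hr0 hrr M S hSc.le hh0 hhb))
  have hK : (s * M : ℝ) ≤ (Finset.univ.filter fun p : Idx n₁ n₂ n₃ =>
      (rightIndex hr0 hrr M S p).isSome).card := by
    rw [← hSc]
    exact_mod_cast le_card_rightIndex_isSome hr0 hrr hle S hSr
  refine le_trans ?_ (div_le_div_of_nonneg_right
    (mul_le_mul_of_nonneg_right hK (sq_nonneg h)) (by positivity))
  have hD0 : 0 ≤ Delta n₂ n₃ s := le_min zero_le_one (by positivity)
  -- One factor of two comes from rounding in `M`, the other from rounding in `r'`: both `Δ n₂ n₃ ≤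
  -- s` and `Δ s ≤ s` are used.
  have hD : Delta n₂ n₃ s * (n₁ * n₂ * n₃) ≤ 4 * (s * M) := by
    have hge' : (n₁ : ℝ) ≤ 2 * (r' * M) := by exact_mod_cast hge
    have hr's' : (n₂ * n₃ * r' : ℝ) ≤ n₂ * n₃ + s := by exact_mod_cast hr's
    have hDs : Delta n₂ n₃ s * (n₂ * n₃) ≤ s := by
      rw [← le_div_iff₀ (by positivity)]; exact min_le_right _ _
    have hDr : Delta n₂ n₃ s * (n₂ * n₃ * r') ≤ 2 * s := by
      calc Delta n₂ n₃ s * (n₂ * n₃ * r') ≤ Delta n₂ n₃ s * (n₂ * n₃ + s) := by gcongr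
        _ = Delta n₂ n₃ s * (n₂ * n₃) + Delta n₂ n₃ s * s := by ring
        _ ≤ s + 1 * s := by
          gcongr
          exact min_le_left _ _
        _ = 2 * s := by ring
    calc Delta n₂ n₃ s * (n₁ * n₂ * n₃) ≤ Delta n₂ n₃ s * (2 * (r' * M) * n₂ * n₃) := by gcongr
      _ = 2 * M * (Delta n₂ n₃ s * (n₂ * n₃ * r')) := by ring
      _ ≤ 2 * M * (2 * s) := by gcongr
      _ = 4 * (s * M) := by ring
  rcases hh with hh | hh
  · rw [hh]
    have h5 : Delta n₂ n₃ s ≤ 4 * (s * M) / (n₁ * n₂ * n₃) := by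
      rwa [le_div_iff₀ (by positivity)]
    have h6 : Delta n₂ n₃ s * b ^ 2 ≤ 4 * (s * M) / (n₁ * n₂ * n₃) * b ^ 2 := by gcongr
    have : s * M * b ^ 2 / (8 * ((n₁ : ℝ) * n₂ * n₃))
        = 4 * (s * M) / (n₁ * n₂ * n₃) * b ^ 2 / 32 := by
      field_simp
      ring
    rw [this]
    linarith [min_le_left (Delta n₂ n₃ s * b ^ 2) (σ ^ 2 * (s / m))]
  · rw [hh]
    have : s * M * (σ ^ 2 / (2 * (m / (n₁ * n₂ * n₃)) * M)) /
        (8 * ((n₁ : ℝ) * n₂ * n₃)) = σ ^ 2 * (s / m) / 16 := by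
      field_simp
      ring
    rw [this]
    have h7 : 0 ≤ σ ^ 2 * (s / m : ℝ) := by positivity
    linarith [min_le_right (Delta n₂ n₃ s * b ^ 2) (σ ^ 2 * (s / m))]

end Rates

end SparseNTF

/-! ### Combination of the two lower bounds -/

theorem proposition4 :
    ∃ C βc : ℝ, 0 < C ∧ 0 < βc ∧
      ∀ (n₁ n₂ n₃ r s m : ℕ) (b σ : ℝ),
        2 ≤ n₁ → 2 ≤ n₂ → 2 ≤ n₃ →
        0 < m → m ≤ n₁ * n₂ * n₃ →
        0 ≤ b → 0 < σ →
        r ≤ min n₁ n₂ → r ≤ s → s ≤ r * n₂ * n₃ →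
        ENNReal.ofReal
            (C * min (SparseNTF.Delta n₂ n₃ s * b ^ 2)
              (βc ^ 2 * σ ^ 2 * (((s : ℝ) + (r : ℝ) * n₁ * n₃) / (m : ℝ)))) ≤
          SparseNTF.minimaxRisk n₁ n₂ n₃ r b s m σ := by
  -- Each cube gives the constant `1 / 32`; the other factor of two is from `min a (x + y) ≤ 2 * min
  -- a (max x y)`.
  refine ⟨1 / 64, 1, by norm_num, by norm_num, ?_⟩
  intro n₁ n₂ n₃ r s m b σ h1 h2 h3 hm0 hm hb hσ hr hrs hsr
  refine le_iInf fun T => ?_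
  set a := SparseNTF.Delta n₂ n₃ s * b ^ 2 with ha
  have ha0 : 0 ≤ a := mul_nonneg (le_min zero_le_one (by positivity)) (sq_nonneg b)
  have htriv : a = 0 → ENNReal.ofReal (1 / 64 * min a
      (1 ^ 2 * σ ^ 2 * (((s : ℝ) + (r : ℝ) * n₁ * n₃) / (m : ℝ)))) = 0 := by
    intro h
    refine ENNReal.ofReal_of_nonpos ?_
    linarith [min_le_left a (1 ^ 2 * σ ^ 2 * (((s : ℝ) + (r : ℝ) * n₁ * n₃) / (m : ℝ)))]
  -- The cubes need `0 < b` (for the left one) and `0 < r`. If `b = 0`, or if `r = 0` and hence `s =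
  -- 0`, then `Δ b² = 0` and the bound is trivial.
  rcases hb.eq_or_lt with hb0 | hb0
  · rw [htriv (by simp [ha, ← hb0])]
    exact zero_le
  rcases Nat.eq_zero_or_pos r with hr0 | hr0
  · have hs : s = 0 := by simpa [hr0] using hsr
    rw [htriv (by simp [ha, hs, SparseNTF.Delta])]
    exact zero_le
  have hL := SparseNTF.iSup_risk_ge_left (by omega) (by omega) (by omega) hm0 hm hb0 hσ hr0
    (hr.trans (min_le_right _ _)) hrs T
  have hR := SparseNTF.iSup_risk_ge_right (by omega) (by omega) (by omega) hm0 hm hb hσ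
    (hr.trans (min_le_left _ _)) (hr0.trans_le hrs) hsr T
  rw [← ha] at hL hR
  have hsplit : 1 ^ 2 * σ ^ 2 * (((s : ℝ) + (r : ℝ) * n₁ * n₃) / (m : ℝ))
      = σ ^ 2 * (s / m) + σ ^ 2 * (r * n₁ * n₃ / m) := by ring
  rw [hsplit]
  set x := σ ^ 2 * ((s : ℝ) / m)
  set y := σ ^ 2 * ((r : ℝ) * n₁ * n₃ / m)
  rcases le_total x y with hxy | hxy
  · refine le_trans (ENNReal.ofReal_le_ofReal ?_) hL
    have : min a (x + y) ≤ 2 * min a y := by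
      rw [mul_min_of_nonneg _ _ zero_le_two]
      exact min_le_min (by linarith) (by linarith)
    linarith
  · refine le_trans (ENNReal.ofReal_le_ofReal ?_) hR
    have : min a (x + y) ≤ 2 * min a x := by
      rw [mul_min_of_nonneg _ _ zero_le_two]
      exact min_le_min (by linarith) (by linarith)
    linarith
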